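/- Let $\mathbb{Q}(t)$ be the field of rational functions, and fix the following data. Let $\mathcal{B}\subseteq\mathbb{R}$ be a basis of $\mathbb{R}$ as a $\mathbb{Q}$-vector space that is dense in $\mathbb{R}$; let $I\subseteq\mathbb{Q}(t)$ be a basis of $\mathbb{Q}(t)$ as a $\mathbb{Q}$-vector space with $1\in I$; and let $(\tilde f_\gamma\colon I\to\mathcal{B})_{\gamma\in 2^{\aleph_0}}$ (indexed by a set of cardinality $2^{\aleph_0}$) be injective functions with pairwise disjoint images such that $\mathcal{B}=\bigcup_\gamma \tilde f_\gamma(I)$ and such that for all pairwise distinct $p_1,\dots,p_m\in I$ and all non-empty open intervals $J_1,\dots,J_m\subseteq\mathbb{R}$ there is $\gamma$ with $\tilde f_\gamma(p_i)\in J_i$ for $i=1,\dots,m$. Let $f_\gamma\colon\mathbb{Q}(t)\to\mathbb{R}$ be the $\mathbb{Q}$-linear extension of $\tilde f_\gamma$. Every $a\in\mathbb{R}$ can be written as $a=\sum_\gamma f_\gamma(p_\gamma)$ for a unique finitely supported family $(p_\gamma)_\gamma$ in $\mathbb{Q}(t)$; for $q\in\mathbb{Q}(t)$ put $\lambda_q(a):=\sum_\gamma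 f_\gamma(q\,p_\gamma)$. Let $\mathcal{L}=\{<,+,0,1\}$, let $T$ be the $\mathcal{L}$-theory of $(\mathbb{R},<,+,0,1)$, let $\mathcal{L}_t$ be $\mathcal{L}$ together with a unary function symbol $\lambda_q$ for every $q\in\mathbb{Q}(t)$, and let $\mathcal{R}_t$ be the $\mathcal{L}_t$-structure $(\mathbb{R},<,+,0,1,(\lambda_q)_{q\in\mathbb{Q}(t)})$. Let $T_t$ be the $\mathcal{L}_t$-theory extending $T$ by axiom schemes stating of a structure $\mathcal{M}$ with underlying set $M$: (T1) $(M,+,0,(\lambda_q)_{q\in\mathbb{Q}(t)})$ is a $\mathbb{Q}(t)$-vector space; (T2) whenever $q_1,\dots,q_m\in\mathbb{Q}(t)$ are $\mathbb{Q}$-linearly independent, the image of $M\to M^m$, $x\mapsto(\lambda_{q_1}(x),\dots,\lambda_{q_m}(x))$, is dense in $M^m$ (with respect to the order topology). Then the complete $\mathcal{L}_t$-theory of $\mathcal{R}_t$ is axiomatized by $T_t$ together with the axiom scheme specifying $\operatorname{tp}_{\mathcal{L}}\big((\lambda_p(1))_{p\in I}\big)$, that is, with all the $\mathcal{L}_t$-sentences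 $\varphi(\lambda_{p_1}(1),\dots,\lambda_{p_n}(1))$ such that $\varphi(x_1,\dots,x_n)$ is an $\mathcal{L}$-formula, $p_1,\dots,p_n\in I$, and $(\mathbb{R},<,+,0,1)\models\varphi(\lambda_{p_1}(1),\dots,\lambda_{p_n}(1))$. In other words, an $\mathcal{L}_t$-sentence is true in $\mathcal{R}_t$ if and only if it is a logical consequence of these axioms. -/

import Mathlib

open FirstOrder FirstOrder.Language

noncomputable section

/-! ### The languages `L` (of `(ℝ, <, +, 0, 1)`) and `L_t` -/

/-- The function symbols `0`, `1`, `+`. -/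
inductive OrdGroupFunc : ℕ → Type
  | zero : OrdGroupFunc 0
  | one : OrdGroupFunc 0
  | add : OrdGroupFunc 2

/-- The relation symbol `<`. -/
inductive OrdGroupRel : ℕ → Type
  | lt : OrdGroupRel 2

/-- The language `L = {<, +, 0, 1}`. -/
def LangL : FirstOrder.Language.{0, 0} := ⟨OrdGroupFunc, OrdGroupRel⟩

/-- One unary function symbol `λ_q` for each rational function `q ∈ ℚ(t)`. -/
inductive LamFunc : ℕ → Type
  | lam (q : RatFunc ℚ) : LamFunc 1

/-- The language of the scalar multiplications alone. -/
def LangLam : FirstOrder.Language.{0, 0} := ⟨LamFunc, fun _ => Empty⟩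

/-- The language `L_t`: the language `L` with the unary function symbols `λ_q`, `q ∈ ℚ(t)`. -/
abbrev LangLt : FirstOrder.Language.{0, 0} := LangL.sum LangLam

/-- The inclusion of the language `L` in `L_t`. -/
abbrev inclL : LangL →ᴸ LangLt := LHom.sumInl

/-- The `L`-structure `(ℝ, <, +, 0, 1)`. -/
instance realStructureL : LangL.Structure ℝ where
  funMap
    | .zero, _ => 0
    | .one, _ => 1
    | .add, v => v 0 + v 1
  RelMap
    | .lt, v => v 0 < v 1

/-- The theory `T` of `(ℝ, <, +, 0, 1)`. -/
def theoryT : LangL.Theory := LangL.completeTheory ℝ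

/-! ### The `L_t`-theory `T_t` -/

namespace LtSyntax

variable {α : Type}

/-- The symbol `0` of `L_t`. -/
def zeroSym : LangLt.Constants := inclL.onFunction OrdGroupFunc.zero

/-- The symbol `1` of `L_t`. -/
def oneSym : LangLt.Constants := inclL.onFunction OrdGroupFunc.one

/-- The symbol `+` of `L_t`. -/
def addSym : LangLt.Functions 2 := inclL.onFunction OrdGroupFunc.add

/-- The symbol `λ_q` of `L_t`. -/
def lamSym (q : RatFunc ℚ) : LangLt.Functions 1 := Sum.inr (LamFunc.lam q)

/-- The symbol `<` of `L_t`. -/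
def ltSym : LangLt.Relations 2 := inclL.onRelation OrdGroupRel.lt

/-- The term `0`. -/
def zeroT : LangLt.Term α := zeroSym.term

/-- The term `1`. -/
def oneT : LangLt.Term α := oneSym.term

/-- The term `s + u`. -/
def addT (s u : LangLt.Term α) : LangLt.Term α := addSym.apply₂ s u

/-- The term `λ_q(s)`. -/
def lamT (q : RatFunc ℚ) (s : LangLt.Term α) : LangLt.Term α := (lamSym q).apply₁ s

/-- The formula `s < u`. -/
def ltF (s u : LangLt.Term α) : LangLt.Formula α := ltSym.formula₂ s u

/-- The axioms stating that `(M, +, 0, (λ_q)_q)` is a `ℚ(t)`-vector space. -/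
def vectorSpaceAxioms : LangLt.Theory :=
  -- `(M, +, 0)` is an abelian group
  {∀' ∀' ∀' (addT (addT (&0) (&1)) (&2) =' addT (&0) (addT (&1) (&2))),
    ∀' ∀' (addT (&0) (&1) =' addT (&1) (&0)),
    ∀' (addT (&0) zeroT =' &0),
    ∀' ∃' (addT (&0) (&1) =' zeroT)} ∪
  -- the scalar multiplication
  (Set.range fun q : RatFunc ℚ =>
    (∀' ∀' (lamT q (addT (&0) (&1)) =' addT (lamT q (&0)) (lamT q (&1))) : LangLt.Sentence)) ∪
  (Set.range fun qr : RatFunc ℚ × RatFunc ℚ =>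
    (∀' (lamT (qr.1 + qr.2) (&0) =' addT (lamT qr.1 (&0)) (lamT qr.2 (&0))) :
      LangLt.Sentence)) ∪
  (Set.range fun qr : RatFunc ℚ × RatFunc ℚ =>
    (∀' (lamT (qr.1 * qr.2) (&0) =' lamT qr.1 (lamT qr.2 (&0))) : LangLt.Sentence)) ∪
  {∀' (lamT 1 (&0) =' &0)}

/-- The sentence
`∀ a₁ … a_m b₁ … b_m, (⋀ᵢ aᵢ < bᵢ) → ∃ x, ⋀ᵢ (aᵢ < λ_{qᵢ}(x) ∧ λ_{qᵢ}(x) < bᵢ)`.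
In models of `T` (dense linear orders without endpoints) the open boxes `∏ᵢ (aᵢ, bᵢ)` with
`aᵢ < bᵢ` form a basis of the topology of `M^m`, so this states that the image of
`x ↦ (λ_{q₁}(x), …, λ_{q_m}(x))` is dense in `M^m`. -/
def densitySentence {m : ℕ} (q : Fin m → RatFunc ℚ) : LangLt.Sentence :=
  Formula.iAlls (α := Empty) (Fin m ⊕ Fin m)
    ((Formula.iInf fun i : Fin m =>
        ltF (var (Sum.inr (Sum.inl i))) (var (Sum.inr (Sum.inr i)))).imp
      (Formula.iExs (α := Empty ⊕ (Fin m ⊕ Fin m)) Unit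
        (Formula.iInf fun i : Fin m =>
          ltF (var (Sum.inl (Sum.inr (Sum.inl i)))) (lamT (q i) (var (Sum.inr ()))) ⊓
          ltF (lamT (q i) (var (Sum.inr ()))) (var (Sum.inl (Sum.inr (Sum.inr i)))))))

/-- The axioms stating that, whenever `q₁, …, q_m ∈ ℚ(t)` are `ℚ`-linearly independent, the image
of `(λ_{q₁}, …, λ_{q_m})` is dense in `M^m`. -/
def densityAxioms : LangLt.Theory :=
  {φ | ∃ (m : ℕ) (q : Fin m → RatFunc ℚ), LinearIndependent ℚ q ∧ φ = densitySentence q}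

end LtSyntax

/-- The `L_t`-theory `T_t`. -/
def theoryTt : LangLt.Theory :=
  inclL.onTheory theoryT ∪ LtSyntax.vectorSpaceAxioms ∪ LtSyntax.densityAxioms

/-! ### The structure `R_t` -/

/-- The choices that go into the construction of `R_t`. The index set `2^ℵ₀` is `ℕ → Bool`. -/
structure RtData where
  /-- A dense basis of `ℝ` as a `ℚ`-vector space. -/
  B : Set ℝ
  B_linearIndependent : LinearIndependent ℚ (Subtype.val : B → ℝ)
  B_span : Submodule.span ℚ B = ⊤
  B_dense : Dense B
  /-- A basis of `ℚ(t)` as a `ℚ`-vector space containing the constant `1`. -/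
  I : Set (RatFunc ℚ)
  I_linearIndependent : LinearIndependent ℚ (Subtype.val : I → RatFunc ℚ)
  I_span : Submodule.span ℚ I = ⊤
  one_mem_I : (1 : RatFunc ℚ) ∈ I
  /-- The functions `f̃_γ : I → B`. -/
  f : (ℕ → Bool) → I → B
  f_cover : ∀ b : B, ∃ γ p, f γ p = b
  f_injective : ∀ γ, Function.Injective (f γ)
  f_disjoint : ∀ γ η, γ ≠ η → Disjoint (Set.range (f γ)) (Set.range (f η))
  f_dense : ∀ (m : ℕ) (p : Fin m → I) (a b : Fin m → ℝ), Function.Injective p →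
    (∀ i, a i < b i) → ∃ γ, ∀ i, (f γ (p i) : ℝ) ∈ Set.Ioo (a i) (b i)

namespace RtData

variable (D : RtData)

/-- `I` as a basis of `ℚ(t)` over `ℚ`. -/
def basisI : Module.Basis D.I ℚ (RatFunc ℚ) :=
  Module.Basis.mk D.I_linearIndependent (by rw [Subtype.range_coe, D.I_span])

/-- `B` as a basis of `ℝ` over `ℚ`. -/
def basisB : Module.Basis D.B ℚ ℝ :=
  Module.Basis.mk D.B_linearIndependent (by rw [Subtype.range_coe, D.B_span])

/-- The `ℚ`-linear map `f_γ : ℚ(t) → ℝ` extending `f̃_γ : I → B`. -/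
def fLin (γ : ℕ → Bool) : RatFunc ℚ →ₗ[ℚ] ℝ :=
  D.basisI.constr ℚ fun p => (D.f γ p : ℝ)

/-- The map sending a finitely supported family `(p_γ)_γ` of rational functions to the real number
`∑_γ f_γ(p_γ)`. -/
def sumMap : ((ℕ → Bool) →₀ RatFunc ℚ) →ₗ[ℚ] ℝ := Finsupp.lsum ℚ D.fLin

/-- Each real number is `∑_γ f_γ(p_γ)` for exactly one finitely supported family `(p_γ)_γ`. -/
theorem sumMap_bijective : Function.Bijective D.sumMap := by
  have he : Function.Bijective fun x : (ℕ → Bool) × D.I => D.f x.1 x.2 := by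
    refine ⟨?_, fun b => ?_⟩
    · rintro ⟨γ, p⟩ ⟨η, r⟩ h
      by_cases hγ : γ = η
      · subst hγ
        exact congrArg (Prod.mk γ) (D.f_injective γ h)
      · exact absurd (D.f_disjoint γ η hγ)
          (Set.not_disjoint_iff.2 ⟨D.f γ p, ⟨p, rfl⟩, ⟨r, h.symm⟩⟩)
    · obtain ⟨γ, p, h⟩ := D.f_cover b
      exact ⟨(γ, p), h⟩
  let E : ((ℕ → Bool) →₀ RatFunc ℚ) ≃ₗ[ℚ] ℝ :=
    Finsupp.mapRange.linearEquiv D.basisI.repr ≪≫ₗ (Finsupp.curryLinearEquiv ℚ).symm ≪≫ₗ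
      Finsupp.domLCongr (Equiv.ofBijective _ he) ≪≫ₗ D.basisB.repr.symm
  have hE : D.sumMap = E.toLinearMap := by
    refine Finsupp.lhom_ext' fun γ => D.basisI.ext fun p => ?_
    simp [E, sumMap, fLin, basisB, Finsupp.curryLinearEquiv]
  rw [hE]
  exact E.bijective

/-- `sumMap` as a linear equivalence. -/
def sumEquiv : ((ℕ → Bool) →₀ RatFunc ℚ) ≃ₗ[ℚ] ℝ :=
  LinearEquiv.ofBijective D.sumMap D.sumMap_bijective

/-- `λ(q, a) = ∑_γ f_γ(q * p_γ)` where `a = ∑_γ f_γ(p_γ)`. -/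
def lam (q : RatFunc ℚ) (a : ℝ) : ℝ :=
  (D.sumEquiv.symm a).sum fun γ p => D.fLin γ (q * p)

/-- The interpretation of the symbols `λ_q` in `ℝ`. -/
abbrev lamStructure : LangLam.Structure ℝ where
  funMap
    | .lam q, v => D.lam q (v 0)
  RelMap := fun r _ => nomatch r

/-- The `L_t`-structure `R_t = (ℝ, <, +, 0, 1, (λ_q)_{q ∈ ℚ(t)})`. -/
abbrev structureRt : LangLt.Structure ℝ :=
  letI := D.lamStructure
  inferInstance

/-- The theory of `R_t`. -/
def theoryRt : LangLt.Theory :=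
  letI := D.structureRt
  LangLt.completeTheory ℝ

/-- The `L`-type of the tuple `(λ_p(1))_{p ∈ I}` in `ℝ`, as a complete type over `T`. -/
def typeOne : theoryT.CompleteType D.I :=
  haveI : ℝ ⊨ theoryT := inferInstanceAs (ℝ ⊨ LangL.completeTheory ℝ)
  theoryT.typeOf fun p : D.I => D.lam p 1

/-- The axiom scheme specifying the `L`-type of `(λ_p(1))_{p ∈ I}`: the sentences
`φ(λ_{p₁}(1), …, λ_{pₙ}(1))` for the `L`-formulas `φ(x_{p₁}, …, x_{pₙ})` in that type. -/
def typeAxioms : LangLt.Theory :=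
  {ψ | ∃ φ : LangL.Formula D.I, Formula.equivSentence φ ∈ D.typeOne ∧
    ψ = (inclL.onFormula φ).subst fun p => LtSyntax.lamT p.1 LtSyntax.oneT}

end RtData

end

noncomputable section

/-! ### Signs of linear forms over ordered `ℚ`-vector spaces -/

/-! A model of $T_t$ is an ordered $\mathbb{Q}(t)$-vector space whose scalar maps are jointly dense.
In such spaces the truth of a formula depends only on the signs of finitely many linear forms
$\lambda_s(1)+\sum_i\lambda_{c_i}(x_i)$ (`exists_determinedBy`), a form of quantifier elimination.

The quantifier step is `exists_finset_elim_field`. If a form with nonzero coefficient vanishes at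
$x$, then $x$ is determined and is substituted. Otherwise the coefficients are expanded in
$\mathbb{Q}$-independent $q_1,\dots,q_n$ and the $q_jx$ are treated as $n$ unrelated variables.
Fourier–Motzkin elimination over $\mathbb{Q}$ (`exists_finset_elim`) finds values for them in the
other model, and density finds one vector $y$ with every $q_jy$ so close to these that no nonzero
sign changes.

For a sentence only the signs of the $\lambda_s(1)$ remain. Since $I$ spans $\mathbb{Q}(t)$, the
type axioms fix them (`exists_formula_pos`), so any two models agree on all sentences. It remains
that $\mathcal{R}_t$ is a model, where density (`exists_lam_mem_Ioo`) comes from the choice of the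
$\tilde f_\gamma$. -/

/-- Two elements of ordered groups have the same sign. -/
def SameSign {M N : Type} [Zero M] [LT M] [Zero N] [LT N] (x : M) (y : N) : Prop :=
  (0 < x ↔ 0 < y) ∧ (x < 0 ↔ y < 0)

namespace SameSign

variable {M N : Type}

theorem symm [Zero M] [LT M] [Zero N] [LT N] {x : M} {y : N} (h : SameSign x y) :
    SameSign y x :=
  ⟨h.1.symm, h.2.symm⟩

theorem eq_zero_iff [Zero M] [LinearOrder M] [Zero N] [LinearOrder N] {x : M} {y : N}
    (h : SameSign x y) : x = 0 ↔ y = 0 := by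
  have h1 := h.1
  have h2 := h.2
  constructor
  · rintro rfl
    exact le_antisymm (not_lt.1 fun hy => lt_irrefl _ (h1.2 hy))
      (not_lt.1 fun hy => lt_irrefl _ (h2.2 hy))
  · rintro rfl
    exact le_antisymm (not_lt.1 fun hy => lt_irrefl _ (h1.1 hy))
      (not_lt.1 fun hy => lt_irrefl _ (h2.1 hy))

theorem of_abs_sub_lt [AddCommGroup N] [LinearOrder N] [IsOrderedAddMonoid N] {x y : N}
    (h : |x - y| < |y|) : SameSign x y := by
  rcases lt_trichotomy y 0 with hy | rfl | hy
  · rw [abs_of_neg hy] at h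
    have hx : x < 0 := by simpa using sub_lt_iff_lt_add.1 (abs_lt.1 h).2
    exact ⟨iff_of_false hx.not_gt hy.not_gt, iff_of_true hx hy⟩
  · rw [abs_zero] at h
    exact absurd h (abs_nonneg _).not_gt
  · rw [abs_of_pos hy] at h
    have hx : 0 < x := by simpa using lt_sub_iff_add_lt.1 (abs_lt.1 h).1
    exact ⟨iff_of_true hx hy, iff_of_false hx.not_gt hy.not_gt⟩

theorem trans {P : Type} [Zero M] [LT M] [Zero N] [LT N] [Zero P] [LT P] {x : M} {y : N} {z : P}
    (h : SameSign x y) (h' : SameSign y z) : SameSign x z :=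
  ⟨h.1.trans h'.1, h.2.trans h'.2⟩

end SameSign

/-- Compatibility with the order is automatic: `q.den • (q • x) = q.num • x`, and positive integer
multiples preserve and reflect positivity. -/
theorem rat_isStrictOrderedModule (M : Type) [AddCommGroup M] [LinearOrder M]
    [IsOrderedAddMonoid M] [Module ℚ M] : IsStrictOrderedModule ℚ M := by
  have key : ∀ (q : ℚ) (x : M), 0 < q → 0 < x → 0 < q • x := by
    intro q x hq hx
    have h : q.den • (q • x) = q.num.toNat • x := by
      rw [← Nat.cast_smul_eq_nsmul ℚ, ← Nat.cast_smul_eq_nsmul ℚ, smul_smul,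
        Rat.den_mul_eq_num]
      congr 1
      exact_mod_cast (Int.toNat_of_nonneg (Rat.num_pos.2 hq).le).symm
    have h2 : 0 < q.num.toNat • x := nsmul_pos hx (by have := Rat.num_pos.2 hq; omega)
    rw [← h] at h2
    exact (nsmul_pos_iff q.den_nz).1 h2
  refine { smul_lt_smul_of_pos_left := fun q hq x y hxy => ?_
           smul_lt_smul_of_pos_right := fun x hx q r hqr => ?_ }
  · have := key q (y - x) hq (sub_pos.2 hxy)
    rwa [smul_sub, sub_pos] at this
  · have := key (r - q) x (sub_pos.2 hqr) hx
    rwa [sub_smul, sub_pos] at this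

theorem rat_denselyOrdered (M : Type) [AddCommGroup M] [LinearOrder M]
    [IsOrderedAddMonoid M] [Module ℚ M] : DenselyOrdered M := by
  have := rat_isStrictOrderedModule M
  refine ⟨fun a b hab => ⟨a + (2⁻¹ : ℚ) • (b - a), ?_, ?_⟩⟩
  · exact lt_add_of_pos_right _ (smul_pos (by norm_num) (sub_pos.2 hab))
  · have h : b = a + (2⁻¹ : ℚ) • (b - a) + (2⁻¹ : ℚ) • (b - a) := by
      rw [add_assoc, ← add_smul]; norm_num
    conv_rhs => rw [h]
    exact lt_add_of_pos_right _ (smul_pos (by norm_num) (sub_pos.2 hab))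

/-! ### Fourier–Motzkin elimination over $\mathbb{Q}$ -/

/-- If `z` is one of the `ρ i`, the matching `ρ' i` works. Otherwise the finitely many points below
and above `z` correspond to finite sets in `N`, one below the other, and density or the absence of
endpoints gives a point between them. -/
theorem exists_same_cut {ι M N : Type} [LinearOrder M] [LinearOrder N] [DenselyOrdered N]
    [NoMinOrder N] [NoMaxOrder N] [Nonempty N] (F : Finset ι) (ρ : ι → M) (ρ' : ι → N)
    (h : ∀ i ∈ F, ∀ j ∈ F, ρ i < ρ j ↔ ρ' i < ρ' j) (z : M) :
    ∃ z' : N, ∀ i ∈ F, (z < ρ i ↔ z' < ρ' i) ∧ (ρ i < z ↔ ρ' i < z') := by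
  classical
  by_cases hz : ∃ i ∈ F, ρ i = z
  · obtain ⟨i, hi, rfl⟩ := hz
    exact ⟨ρ' i, fun j hj => ⟨h i hi j hj, h j hj i hi⟩⟩
  · push Not at hz
    obtain ⟨m, hlo, hhi⟩ := Order.exists_between_finsets
      ((F.filter fun i => ρ i < z).image ρ') ((F.filter fun i => z < ρ i).image ρ') (by
        intro x hx y hy
        simp only [Finset.mem_image, Finset.mem_filter] at hx hy
        obtain ⟨i, ⟨hi, hi'⟩, rfl⟩ := hx
        obtain ⟨j, ⟨hj, hj'⟩, rfl⟩ := hy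
        exact (h i hi j hj).1 (hi'.trans hj'))
    refine ⟨m, fun i hi => ?_⟩
    rcases lt_or_gt_of_ne (hz i hi) with hlt | hlt
    · have := hlo (ρ' i) (Finset.mem_image_of_mem _ (Finset.mem_filter.2 ⟨hi, hlt⟩))
      exact ⟨iff_of_false hlt.not_gt this.not_gt, iff_of_true hlt this⟩
    · have := hhi (ρ' i) (Finset.mem_image_of_mem _ (Finset.mem_filter.2 ⟨hi, hlt⟩))
      exact ⟨iff_of_true hlt this, iff_of_false hlt.not_gt this.not_gt⟩

/-- The sign of a form with nonzero slope is the position of `z` relative to the root; a negative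
slope reverses the order. -/
theorem smul_add_pos_iff {M : Type} [AddCommGroup M] [LinearOrder M]
    [IsOrderedAddMonoid M] [Module ℚ M] {q : ℚ} (z w : M) :
    (0 < q → ((0 < q • z + w ↔ -(q⁻¹ • w) < z) ∧ (q • z + w < 0 ↔ z < -(q⁻¹ • w)))) ∧
    (q < 0 → ((0 < q • z + w ↔ z < -(q⁻¹ • w)) ∧ (q • z + w < 0 ↔ -(q⁻¹ • w) < z))) := by
  have := rat_isStrictOrderedModule M
  have e : q ≠ 0 → q • z + w = q • (z - -(q⁻¹ • w)) := by
    intro hq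
    rw [sub_neg_eq_add, smul_add, smul_smul, mul_inv_cancel₀ hq, one_smul]
  refine ⟨fun hq => ?_, fun hq => ?_⟩
  · rw [e hq.ne', smul_pos_iff_of_pos_left hq, smul_neg_iff_of_pos_left hq, sub_pos, sub_neg]
    simp
  · rw [e hq.ne, smul_pos_iff_of_neg_left hq, smul_neg_iff_of_neg_left hq, sub_pos, sub_neg]
    simp

/-- Elimination of one variable from finitely many linear forms over `ℚ`. -/
theorem exists_finset_elim_one {W : Type} [AddCommGroup W] [Module ℚ W] (F : Finset (ℚ × W)) :
    ∃ F' : Finset W, ∀ (M N : Type) [AddCommGroup M] [LinearOrder M] [IsOrderedAddMonoid M]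
      [Module ℚ M] [AddCommGroup N] [LinearOrder N] [IsOrderedAddMonoid N] [Module ℚ N]
      [Nontrivial N] (e : W →ₗ[ℚ] M) (e' : W →ₗ[ℚ] N),
      (∀ w ∈ F', SameSign (e w) (e' w)) → ∀ z : M, ∃ z' : N, ∀ p ∈ F,
        SameSign (p.1 • z + e p.2) (p.1 • z' + e' p.2) := by
  classical
  -- Differences of roots record the order of the roots; the constant parts decide the forms with
  -- zero coefficient. For those, the inverse is `0` and the extra root `0` is harmless.
  refine ⟨F.image Prod.snd ∪
    (F ×ˢ F).image fun x => x.1.1⁻¹ • x.1.2 - x.2.1⁻¹ • x.2.2, ?_⟩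
  intro M N _ _ _ _ _ _ _ _ _ e e' h z
  have := rat_denselyOrdered N
  obtain ⟨z', hz'⟩ := exists_same_cut F (fun p => -(p.1⁻¹ • e p.2)) (fun p => -(p.1⁻¹ • e' p.2))
    (by
      intro i hi j hj
      have := h (i.1⁻¹ • i.2 - j.1⁻¹ • j.2) (Finset.mem_union_right _
        (Finset.mem_image.2 ⟨(i, j), Finset.mem_product.2 ⟨hi, hj⟩, rfl⟩))
      simpa using this.1) z
  refine ⟨z', fun p hp => ?_⟩
  obtain ⟨h1, h2⟩ := hz' p hp
  rcases lt_trichotomy p.1 0 with hq | hq | hq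
  · have a := (smul_add_pos_iff z (e p.2)).2 hq
    have b := (smul_add_pos_iff z' (e' p.2)).2 hq
    exact ⟨a.1.trans (h1.trans b.1.symm), a.2.trans (h2.trans b.2.symm)⟩
  · rw [hq, zero_smul, zero_smul, zero_add, zero_add]
    exact h _ (Finset.mem_union_left _ (Finset.mem_image_of_mem _ hp))
  · have a := (smul_add_pos_iff z (e p.2)).1 hq
    have b := (smul_add_pos_iff z' (e' p.2)).1 hq
    exact ⟨a.1.trans (h2.trans b.1.symm), a.2.trans (h1.trans b.2.symm)⟩

/-- Elimination of `n` variables from finitely many linear forms over `ℚ`. -/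
theorem exists_finset_elim (n : ℕ) : ∀ {W : Type} [AddCommGroup W] [Module ℚ W]
    (F : Finset ((Fin n → ℚ) × W)),
    ∃ F' : Finset W, ∀ (M N : Type) [AddCommGroup M] [LinearOrder M] [IsOrderedAddMonoid M]
      [Module ℚ M] [AddCommGroup N] [LinearOrder N] [IsOrderedAddMonoid N] [Module ℚ N]
      [Nontrivial N] (e : W →ₗ[ℚ] M) (e' : W →ₗ[ℚ] N),
      (∀ w ∈ F', SameSign (e w) (e' w)) → ∀ z : Fin n → M, ∃ z' : Fin n → N, ∀ p ∈ F,
        SameSign (∑ i, p.1 i • z i + e p.2) (∑ i, p.1 i • z' i + e' p.2) := by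
  classical
  induction n with
  | zero =>
    intro W _ _ F
    refine ⟨F.image Prod.snd, ?_⟩
    intro M N _ _ _ _ _ _ _ _ _ e e' h z
    refine ⟨fun i => 0, fun p hp => ?_⟩
    simpa using h p.2 (Finset.mem_image_of_mem _ hp)
  | succ n ih =>
    intro W _ _ F
    -- Variable `0` is eliminated while the other variables are absorbed into the constant space
    -- `(Fin n → ℚ) × W`; this is why the induction is over all `W`.
    obtain ⟨F₂, hF₂⟩ := exists_finset_elim_one
      (F.image fun p => (p.1 0, ((fun i : Fin n => p.1 i.succ, p.2) : (Fin n → ℚ) × W)))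
    obtain ⟨F₁, hF₁⟩ := ih F₂
    refine ⟨F₁, ?_⟩
    intro M N _ _ _ _ _ _ _ _ _ e e' h z
    obtain ⟨y, hy⟩ := hF₁ M N e e' h fun i => z i.succ
    obtain ⟨y₀, hy₀⟩ := hF₂ M N ((Fintype.linearCombination ℚ fun i : Fin n => z i.succ).coprod e)
      ((Fintype.linearCombination ℚ y).coprod e') (by
        intro w hw
        simpa [Fintype.linearCombination_apply] using hy w hw) (z 0)
    refine ⟨Fin.cons y₀ y, fun p hp => ?_⟩
    have := hy₀ _ (Finset.mem_image_of_mem _ hp)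
    simpa [Fintype.linearCombination_apply, Fin.sum_univ_succ, add_assoc] using this

/-! ### Elimination over a larger field by density -/

/-- The scalar multiplications by `ℚ`-linearly independent scalars have jointly dense image. -/
def DenseScalars (K N : Type) [Field K] [Algebra ℚ K] [AddCommGroup N] [LT N] [Module K N] :
    Prop :=
  ∀ (m : ℕ) (q : Fin m → K), LinearIndependent ℚ q → ∀ a b : Fin m → N, (∀ i, a i < b i) →
    ∃ x : N, ∀ i, a i < q i • x ∧ q i • x < b i

/-- This turns each `s • x` into a `ℚ`-linear form in the tuple `q j • x`, with `q` independent as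
`DenseScalars` requires. -/
theorem exists_rat_coords {K : Type} [Field K] [Algebra ℚ K] (S : Finset K) :
    ∃ (n : ℕ) (q : Fin n → K), LinearIndependent ℚ q ∧
      ∃ A : K → Fin n → ℚ, ∀ s ∈ S, ∑ j, A s j • q j = s := by
  classical
  let V := Submodule.span ℚ (S : Set K)
  let b := Module.finBasis ℚ V
  refine ⟨_, fun j => (b j : K), b.linearIndependent.map' V.subtype V.ker_subtype,
    fun s j => if h : s ∈ V then b.repr ⟨s, h⟩ j else 0, fun s hs => ?_⟩
  have hV : s ∈ V := Submodule.subset_span hs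
  have := congrArg (V.subtype) (b.sum_repr ⟨s, hV⟩)
  rw [map_sum] at this
  simpa only [hV, dite_true, map_smul, Submodule.subtype_apply] using this

/-- Near a tuple of elements, finitely many linear forms keep their nonzero signs. -/
theorem exists_sameSign_of_close {ι N : Type} [AddCommGroup N] [LinearOrder N]
    [IsOrderedAddMonoid N] [Module ℚ N] [Nontrivial N] {n : ℕ} (F : Finset ι)
    (A : ι → Fin n → ℚ) (c : ι → N) (z : Fin n → N)
    (hz : ∀ i ∈ F, ∑ j, A i j • z j + c i ≠ 0) :
    ∃ δ : N, 0 < δ ∧ ∀ y : Fin n → N, (∀ j, |y j - z j| < δ) →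
      ∀ i ∈ F, SameSign (∑ j, A i j • y j + c i) (∑ j, A i j • z j + c i) := by
  classical
  have := rat_isStrictOrderedModule N
  induction F using Finset.induction_on with
  | empty =>
    obtain ⟨δ, hδ⟩ := exists_gt (0 : N)
    exact ⟨δ, hδ, by simp⟩
  | insert i F _ ih =>
    obtain ⟨δ, hδ, h⟩ := ih fun i hi => hz i (Finset.mem_insert_of_mem hi)
    have hK : (0 : ℚ) < (∑ j, |A i j|) + 1 :=
      add_pos_of_nonneg_of_pos (Finset.sum_nonneg fun _ _ => abs_nonneg _) one_pos
    set v := ∑ j, A i j • z j + c i with hv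
    have hv0 : 0 < |v| := abs_pos.2 (hz i (Finset.mem_insert_self _ _))
    -- A perturbation below `ε` moves the form by at most `(∑ j, |A i j|) • ε`, which is less than
    -- `|v|` because of the summand `1`; that summand also keeps the divisor nonzero.
    set ε := ((∑ j, |A i j|) + 1)⁻¹ • |v| with hε
    have hε0 : 0 < ε := smul_pos (inv_pos.2 hK) hv0
    refine ⟨min δ ε, lt_min hδ hε0, fun y hy k hk => ?_⟩
    rcases Finset.mem_insert.1 hk with rfl | hk
    · refine SameSign.of_abs_sub_lt ?_
      have e1 : ∑ j, A k j • y j + c k - v = ∑ j, A k j • (y j - z j) := by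
        simp only [hv, smul_sub, Finset.sum_sub_distrib]
        abel
      have e2 : |v| = ((∑ j, |A k j|) + 1) • ε := by
        rw [hε, smul_smul, mul_inv_cancel₀ hK.ne', one_smul]
      rw [← hv, e1, e2, add_smul, one_smul, Finset.sum_smul]
      refine lt_of_le_of_lt (Finset.abs_sum_le_sum_abs _ _) (lt_add_of_le_of_pos
        (Finset.sum_le_sum fun j _ => ?_) hε0)
      rw [abs_smul]
      exact smul_le_smul_of_nonneg_left ((hy j).le.trans (min_le_right _ _)) (abs_nonneg _)
    · exact h y (fun j => (hy j).trans_le (min_le_left _ _)) k hk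

/-- Elimination of one variable from finitely many linear forms over a field `K` containing `ℚ`,
in ordered `K`-vector spaces with dense scalars. -/
theorem exists_finset_elim_field {K W : Type} [Field K] [Algebra ℚ K] [AddCommGroup W] [Module K W]
    [Module ℚ W] [IsScalarTower ℚ K W] (F : Finset (K × W)) :
    ∃ F' : Finset W, ∀ (M N : Type) [AddCommGroup M] [LinearOrder M] [IsOrderedAddMonoid M]
      [Module K M] [Module ℚ M] [IsScalarTower ℚ K M]
      [AddCommGroup N] [LinearOrder N] [IsOrderedAddMonoid N]
      [Module K N] [Module ℚ N] [IsScalarTower ℚ K N]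
      [Nontrivial N] (_ : DenseScalars K N) (e : W →ₗ[K] M) (e' : W →ₗ[K] N),
      (∀ w ∈ F', SameSign (e w) (e' w)) → ∀ z : M, ∃ z' : N, ∀ p ∈ F,
        SameSign (p.1 • z + e p.2) (p.1 • z' + e' p.2) := by
  classical
  obtain ⟨n, q, hq, A, hA⟩ := exists_rat_coords (F.image Prod.fst)
  replace hA : ∀ p ∈ F, ∑ j, A p.1 j • q j = p.1 :=
    fun p hp => hA _ (Finset.mem_image_of_mem _ hp)
  obtain ⟨F₁, hF₁⟩ := exists_finset_elim n (F.image fun p => (A p.1, p.2))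
  -- The second set consists of the forms `r` evaluated at the root of `p`.
  refine ⟨F₁ ∪ (F ×ˢ F).image fun x => x.1.2 - x.1.1 • x.2.1⁻¹ • x.2.2, ?_⟩
  intro M N _ _ _ _ _ _ _ _ _ _ _ _ _ hN e e' h x
  have hpair : ∀ r ∈ F, ∀ p ∈ F, SameSign (e (r.2 - r.1 • p.1⁻¹ • p.2))
      (e' (r.2 - r.1 • p.1⁻¹ • p.2)) := fun r hr p hp => h _ (Finset.mem_union_right _
        (Finset.mem_image.2 ⟨(r, p), Finset.mem_product.2 ⟨hr, hp⟩, rfl⟩))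
  -- An equation cannot be met by approximation, so a vanishing form is solved for `x` exactly.
  by_cases hx : ∃ p ∈ F, p.1 ≠ 0 ∧ p.1 • x + e p.2 = 0
  · obtain ⟨p, hp, hp0, hpx⟩ := hx
    have hx' : x = -(p.1⁻¹ • e p.2) := by
      rw [← add_eq_zero_iff_eq_neg, ← smul_right_injective M hp0 |>.eq_iff]
      simpa [smul_smul, hp0] using hpx
    refine ⟨-(p.1⁻¹ • e' p.2), fun r hr => ?_⟩
    have := hpair r hr p hp
    simp only [map_sub, map_smul] at this
    rw [hx', smul_neg, smul_neg, neg_add_eq_sub, neg_add_eq_sub]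
    exact this
  · push Not at hx
    -- The `z' j` have the right signs but need not be the multiples `q j • y` of a single vector.
    obtain ⟨z', hz'⟩ := hF₁ M N (e.restrictScalars ℚ) (e'.restrictScalars ℚ)
      (fun w hw => h w (Finset.mem_union_left _ hw)) fun j => q j • x
    have hsum : ∀ (L : Type) [AddCommGroup L] [Module K L] [Module ℚ L] [IsScalarTower ℚ K L]
        (y : L), ∀ p ∈ F, ∑ j, A p.1 j • q j • y = p.1 • y := by
      intro L _ _ _ _ y p hp
      conv_rhs => rw [← hA p hp, Finset.sum_smul]
      simp
    replace hz' : ∀ p ∈ F, SameSign (p.1 • x + e p.2) (∑ j, A p.1 j • z' j + e' p.2) := by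
      intro p hp
      have := hz' _ (Finset.mem_image_of_mem _ hp)
      simp only [LinearMap.coe_restrictScalars] at this
      rwa [hsum M x p hp] at this
    obtain ⟨δ, hδ, hclose⟩ := exists_sameSign_of_close (F.filter fun p => p.1 ≠ 0)
      (fun p => A p.1) (fun p => e' p.2) z' (by
        intro p hp
        obtain ⟨hp, hp0⟩ := Finset.mem_filter.1 hp
        exact fun h0 => hx p hp hp0 ((hz' p hp).eq_zero_iff.2 h0))
    obtain ⟨y, hy⟩ := hN n q hq (fun j => z' j - δ) (fun j => z' j + δ)
      fun j => (sub_lt_self _ hδ).trans (lt_add_of_pos_right _ hδ)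
    refine ⟨y, fun p hp => ?_⟩
    by_cases hp0 : p.1 = 0
    -- With zero coefficient, the form attached to the pair `(p, p)` is `p.2` itself.
    · have := hpair p hp p hp
      simpa [hp0] using this
    · have := hclose (fun j => q j • y)
        (fun j => abs_sub_lt_iff.2 ⟨sub_left_lt_of_lt_add (hy j).2, sub_lt_comm.1 (hy j).1⟩) p
        (Finset.mem_filter.2 ⟨hp, hp0⟩)
      rw [hsum N y p hp] at this
      exact (hz' p hp).trans this.symm

/-! ### Models of `T_t` as ordered `ℚ(t)`-vector spaces -/

namespace OrdGroupSyntax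

/-- The symbol `<` of `L`. -/
def ltSym : LangL.Relations 2 := OrdGroupRel.lt

/-- The symbol `+` of `L`. -/
def addSym : LangL.Functions 2 := OrdGroupFunc.add

/-- The symbol `0` of `L`. -/
def zeroSym : LangL.Constants := OrdGroupFunc.zero

/-- The symbol `1` of `L`. -/
def oneSym : LangL.Constants := OrdGroupFunc.one

/-- Irreflexivity of `<`. -/
def irreflSentence : LangL.Sentence := ∀' ∼(ltSym.boundedFormula₂ (&0) (&0))

/-- Transitivity of `<`. -/
def transSentence : LangL.Sentence :=
  ∀' ∀' ∀' (ltSym.boundedFormula₂ (&0) (&1) ⟹ ltSym.boundedFormula₂ (&1) (&2) ⟹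
    ltSym.boundedFormula₂ (&0) (&2))

/-- Trichotomy of `<`. -/
def totalSentence : LangL.Sentence :=
  ∀' ∀' (∼(ltSym.boundedFormula₂ (&0) (&1)) ⟹ ∼(&0 =' &1) ⟹ ltSym.boundedFormula₂ (&1) (&0))

/-- Monotonicity of addition. -/
def addMonoSentence : LangL.Sentence :=
  ∀' ∀' ∀' (ltSym.boundedFormula₂ (&0) (&1) ⟹
    ltSym.boundedFormula₂ (addSym.apply₂ (&2) (&0)) (addSym.apply₂ (&2) (&1)))

/-- Positivity of `1`. -/
def onePosSentence : LangL.Sentence := ltSym.formula₂ zeroSym.term oneSym.term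

variable (M : Type) [LangL.Structure M]

theorem realize_irreflSentence :
    M ⊨ irreflSentence ↔ ∀ x : M, ¬ Structure.RelMap ltSym ![x, x] := by
  simp [Sentence.Realize, Formula.Realize, irreflSentence, BoundedFormula.realize_rel₂, Fin.snoc]

theorem realize_transSentence :
    M ⊨ transSentence ↔ ∀ x y z : M, Structure.RelMap ltSym ![x, y] →
      Structure.RelMap ltSym ![y, z] → Structure.RelMap ltSym ![x, z] := by
  simp [Sentence.Realize, Formula.Realize, transSentence, BoundedFormula.realize_rel₂, Fin.snoc]

theorem realize_totalSentence :
    M ⊨ totalSentence ↔ ∀ x y : M, ¬ Structure.RelMap ltSym ![x, y] → ¬ x = y →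
      Structure.RelMap ltSym ![y, x] := by
  simp [Sentence.Realize, Formula.Realize, totalSentence, BoundedFormula.realize_rel₂, Fin.snoc]

theorem realize_addMonoSentence :
    M ⊨ addMonoSentence ↔ ∀ x y z : M, Structure.RelMap ltSym ![x, y] →
      Structure.RelMap ltSym ![Structure.funMap addSym ![z, x], Structure.funMap addSym ![z, y] ] := by
  simp [Sentence.Realize, Formula.Realize, addMonoSentence, BoundedFormula.realize_rel₂, Fin.snoc]

theorem realize_onePosSentence :
    M ⊨ onePosSentence ↔ Structure.RelMap ltSym ![(zeroSym : M), (oneSym : M)] := by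
  simp [Sentence.Realize, onePosSentence, Formula.realize_rel₂]

end OrdGroupSyntax

open LtSyntax

/-- The symbols of `L_t` are interpreted in `M` by the operations of an ordered `ℚ(t)`-vector space
with dense scalars. -/
structure IsLtSpace (M : Type) [LangLt.Structure M] [AddCommGroup M] [LinearOrder M]
    [Module (RatFunc ℚ) M] : Prop where
  zero_eq : (zeroSym : M) = 0
  one_pos : 0 < (oneSym : M)
  add_eq : ∀ x y : M, Structure.funMap addSym ![x, y] = x + y
  lam_eq : ∀ (q : RatFunc ℚ) (x : M), Structure.funMap (lamSym q) ![x] = q • x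
  lt_iff : ∀ x y : M, Structure.RelMap ltSym ![x, y] ↔ x < y
  dense : DenseScalars (RatFunc ℚ) M

theorem realize_densitySentence (M : Type) [LangLt.Structure M] {m : ℕ} (q : Fin m → RatFunc ℚ) :
    M ⊨ densitySentence q ↔ ∀ a b : Fin m → M, (∀ i, Structure.RelMap ltSym ![a i, b i]) →
      ∃ x : M, ∀ i, Structure.RelMap ltSym ![a i, Structure.funMap (lamSym (q i)) ![x] ] ∧
        Structure.RelMap ltSym ![Structure.funMap (lamSym (q i)) ![x], b i] := by
  simp only [Sentence.Realize, densitySentence, Formula.realize_iAlls, Formula.realize_imp,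
    Formula.realize_iInf, Formula.realize_iExs, ltF, lamT, Formula.realize_inf,
    Formula.realize_rel₂, Term.realize_functions_apply₁, Term.realize_var, Sum.elim_inl,
    Sum.elim_inr]
  constructor
  · intro h a b hab
    obtain ⟨x, hx⟩ := h (Sum.elim a b) hab
    exact ⟨x (), hx⟩
  · intro h s hs
    obtain ⟨x, hx⟩ := h _ _ hs
    exact ⟨fun _ => x, hx⟩

theorem realize_vectorSpaceAxioms (M : Type) [LangLt.Structure M] :
    M ⊨ vectorSpaceAxioms ↔
      (∀ x y z : M, Structure.funMap addSym ![Structure.funMap addSym ![x, y], z] =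
        Structure.funMap addSym ![x, Structure.funMap addSym ![y, z] ]) ∧
      (∀ x y : M, Structure.funMap addSym ![x, y] = Structure.funMap addSym ![y, x]) ∧
      (∀ x : M, Structure.funMap addSym ![x, zeroSym] = x) ∧
      (∀ x : M, ∃ y : M, Structure.funMap addSym ![x, y] = (zeroSym : M)) ∧
      (∀ (q : RatFunc ℚ) (x y : M), Structure.funMap (lamSym q) ![Structure.funMap addSym ![x, y] ] =
        Structure.funMap addSym ![Structure.funMap (lamSym q) ![x],
          Structure.funMap (lamSym q) ![y] ]) ∧
      (∀ (q r : RatFunc ℚ) (x : M), Structure.funMap (lamSym (q + r)) ![x] =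
        Structure.funMap addSym ![Structure.funMap (lamSym q) ![x],
          Structure.funMap (lamSym r) ![x] ]) ∧
      (∀ (q r : RatFunc ℚ) (x : M), Structure.funMap (lamSym (q * r)) ![x] =
        Structure.funMap (lamSym q) ![Structure.funMap (lamSym r) ![x] ]) ∧
      (∀ x : M, Structure.funMap (lamSym 1) ![x] = x) := by
  simp only [vectorSpaceAxioms, Theory.model_iff, Set.mem_union, Set.mem_insert_iff,
    Set.mem_singleton_iff, Set.mem_range, or_imp, forall_and, forall_eq, forall_exists_index,
    forall_apply_eq_imp_iff, and_assoc]
  simp [Sentence.Realize, Formula.Realize, addT, lamT, zeroT, Fin.snoc]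

/-- Since `theoryT` is the complete theory of `ℝ`, the order axioms, monotonicity of addition and `0
< 1` pass to `M` as sentences true in `ℝ`; the rest is read off the two axiom schemes. -/
theorem IsLtSpace.exists_of_model (M : Type) [LangLt.Structure M] (hM : M ⊨ theoryTt) :
    ∃ (_ : AddCommGroup M) (_ : LinearOrder M) (_ : IsOrderedAddMonoid M)
      (_ : Module (RatFunc ℚ) M), IsLtSpace M := by
  classical
  rw [theoryTt, Theory.model_union_iff, Theory.model_union_iff] at hM
  obtain ⟨⟨hT, hV⟩, hD⟩ := hM
  obtain ⟨add_assoc', add_comm', add_zero', exists_neg', lam_add', add_lam', mul_lam', one_lam'⟩ :=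
    (realize_vectorSpaceAxioms M).1 hV
  let _ : LangL.Structure M := inclL.reduct M
  have : inclL.IsExpansionOn M := LHom.isExpansionOn_reduct inclL M
  rw [LHom.onTheory_model] at hT
  have hT' : ∀ φ : LangL.Sentence, ℝ ⊨ φ → M ⊨ φ := fun φ hφ => Theory.realize_sentence_of_mem
    theoryT (show φ ∈ LangL.completeTheory ℝ from hφ)
  have hirr := (OrdGroupSyntax.realize_irreflSentence M).1 (hT' _
    ((OrdGroupSyntax.realize_irreflSentence ℝ).2 fun x => lt_irrefl x))
  have htrans := (OrdGroupSyntax.realize_transSentence M).1 (hT' _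
    ((OrdGroupSyntax.realize_transSentence ℝ).2 fun x y z => lt_trans (α := ℝ)))
  have htotal := (OrdGroupSyntax.realize_totalSentence M).1 (hT' _
    ((OrdGroupSyntax.realize_totalSentence ℝ).2 fun x y h h' => lt_of_le_of_ne (not_lt.1 h)
      (Ne.symm h')))
  have hmono := (OrdGroupSyntax.realize_addMonoSentence M).1 (hT' _
    ((OrdGroupSyntax.realize_addMonoSentence ℝ).2 fun x y z h =>
      (add_lt_add_iff_left (α := ℝ) z).2 h))
  have hone := (OrdGroupSyntax.realize_onePosSentence M).1 (hT' _
    ((OrdGroupSyntax.realize_onePosSentence ℝ).2 (zero_lt_one (α := ℝ))))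
  choose neg hneg using exists_neg'
  let instAdd : Add M := ⟨fun x y => Structure.funMap addSym ![x, y]⟩
  let instZero : Zero M := ⟨(zeroSym : M)⟩
  let instNeg : Neg M := ⟨neg⟩
  let instG : AddCommGroup M :=
    { AddGroup.ofLeftAxioms add_assoc' (fun x => (add_comm' _ _).trans (add_zero' x))
        (fun x => (add_comm' _ _).trans (hneg x)) with
      add_comm := add_comm' }
  let instO : LinearOrder M :=
    { le := fun x y => x = y ∨ Structure.RelMap ltSym ![x, y]
      lt := fun x y => Structure.RelMap ltSym ![x, y]
      le_refl := fun x => Or.inl rfl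
      le_trans := by
        rintro x y z (rfl | h) (rfl | h')
        · exact Or.inl rfl
        · exact Or.inr h'
        · exact Or.inr h
        · exact Or.inr (htrans _ _ _ h h')
      lt_iff_le_not_ge := fun x y => by
        refine ⟨fun h => ⟨Or.inr h, ?_⟩, ?_⟩
        · rintro (rfl | h')
          · exact hirr _ h
          · exact hirr _ (htrans _ _ _ h h')
        · rintro ⟨rfl | h, h'⟩
          · exact absurd (Or.inl rfl) h'
          · exact h
      le_antisymm := by
        rintro x y (rfl | h) (h' | h')
        · rfl
        · rfl
        · exact h'.symm
        · exact absurd (htrans _ _ _ h h') (hirr _)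
      le_total := fun x y => by
        by_cases h : Structure.RelMap ltSym ![x, y]
        · exact Or.inl (Or.inr h)
        · by_cases h' : x = y
          · exact Or.inl (Or.inl h')
          · exact Or.inr (Or.inr (htotal x y h h'))
      toDecidableLE := Classical.decRel _ }
  have instOA : IsOrderedAddMonoid M :=
    { add_le_add_left := by
        rintro x y (rfl | h) z
        · exact le_rfl
        · rw [add_comm x, add_comm y]
          exact Or.inr (hmono x y z h) }
  let instS : SMul (RatFunc ℚ) M := ⟨fun q x => Structure.funMap (lamSym q) ![x]⟩
  let instM : Module (RatFunc ℚ) M :=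
    Module.ofMinimalAxioms lam_add' add_lam' mul_lam' one_lam'
  refine ⟨instG, instO, instOA, instM, ⟨rfl, hone, fun _ _ => rfl, fun _ _ => rfl,
    fun _ _ => Iff.rfl, fun m q hq a b hab => ?_⟩⟩
  have := hD.realize_of_mem _ ⟨m, q, hq, rfl⟩
  exact (realize_densitySentence M q).1 this a b hab

/-! ### Formulas of `L_t` are determined by the signs of finitely many linear forms -/

/-- The value `λ_s(1) + ∑ i, λ_{cᵢ}(xᵢ)` of the form `(s, c)` at the tuple `x`. -/
def evalForm {M : Type} [LangLt.Structure M] [AddCommGroup M] [Module (RatFunc ℚ) M] {n : ℕ}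
    (x : Fin n → M) : RatFunc ℚ × (Fin n → RatFunc ℚ) →ₗ[RatFunc ℚ] M :=
  (LinearMap.toSpanSingleton (RatFunc ℚ) M (oneSym : M)).coprod
    (Fintype.linearCombination (RatFunc ℚ) x)

theorem evalForm_apply {M : Type} [LangLt.Structure M] [AddCommGroup M] [Module (RatFunc ℚ) M]
    {n : ℕ} (x : Fin n → M) (w : RatFunc ℚ × (Fin n → RatFunc ℚ)) :
    evalForm x w = w.1 • (oneSym : M) + ∑ i, w.2 i • x i := by
  simp [evalForm, Fintype.linearCombination_apply]

/-- This isolates the quantified variable in the shape that `exists_finset_elim_field` eliminates.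
-/
theorem evalForm_snoc {M : Type} [LangLt.Structure M] [AddCommGroup M] [Module (RatFunc ℚ) M]
    {n : ℕ} (x : Fin n → M) (z : M) (w : RatFunc ℚ × (Fin (n + 1) → RatFunc ℚ)) :
    evalForm (Fin.snoc x z : Fin (n + 1) → M) w =
      w.2 (Fin.last n) • z + evalForm x (w.1, fun i => w.2 i.castSucc) := by
  simp only [evalForm_apply, Fin.sum_univ_castSucc, Fin.snoc_castSucc, Fin.snoc_last]
  abel

/-- All function symbols act linearly in `1` and the variables. The form `w` is chosen before the
model, so that it can be compared across models. -/
theorem exists_evalForm_eq_realize {n : ℕ} (t : LangLt.Term (Empty ⊕ Fin n)) :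
    ∃ w : RatFunc ℚ × (Fin n → RatFunc ℚ), ∀ (M : Type) [LangLt.Structure M] [AddCommGroup M]
      [LinearOrder M] [Module (RatFunc ℚ) M], IsLtSpace M → ∀ (v : Empty → M) (x : Fin n → M),
        t.realize (Sum.elim v x) = evalForm x w := by
  classical
  induction t with
  | var i =>
    rcases i with i | i
    · exact i.elim
    · refine ⟨(0, Pi.single i 1), fun M _ _ _ _ _ v x => ?_⟩
      simp [evalForm, Fintype.linearCombination_apply_single]
  | func f ts ih =>
    choose w hw using ih
    rcases f with f | f
    · cases f with
      | zero =>
        refine ⟨0, fun M _ _ _ _ hM v x => ?_⟩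
        change Structure.funMap (L := LangLt) zeroSym (fun i => (ts i).realize (Sum.elim v x)) = _
        rw [map_zero, ← hM.zero_eq, funMap_eq_coe_constants]
      | one =>
        refine ⟨(1, 0), fun M _ _ _ _ hM v x => ?_⟩
        change Structure.funMap (L := LangLt) oneSym (fun i => (ts i).realize (Sum.elim v x)) = _
        rw [evalForm_apply, one_smul, Finset.sum_eq_zero (by simp), add_zero,
          funMap_eq_coe_constants]
      | add =>
        refine ⟨w 0 + w 1, fun M _ _ _ _ hM v x => ?_⟩
        change Structure.funMap (L := LangLt) addSym (fun i => (ts i).realize (Sum.elim v x)) = _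
        rw [map_add, ← hw 0 M hM v x, ← hw 1 M hM v x, ← hM.add_eq]
        congr 1
        ext i
        fin_cases i <;> rfl
    · obtain ⟨q⟩ := f
      refine ⟨q • w 0, fun M _ _ _ _ hM v x => ?_⟩
      change Structure.funMap (L := LangLt) (lamSym q) (fun i => (ts i).realize (Sum.elim v x)) = _
      rw [map_smul, ← hw 0 M hM v x, ← hM.lam_eq]
      congr 1
      ext i
      fin_cases i
      rfl

/-- The truth of `φ` at a tuple in an ordered `ℚ(t)`-vector space with dense scalars depends only
on the signs of the forms in the finite set `F`. -/
def DeterminedBy {n : ℕ} (φ : LangLt.BoundedFormula Empty n)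
    (F : Finset (RatFunc ℚ × (Fin n → RatFunc ℚ))) : Prop :=
  ∀ (M N : Type) [LangLt.Structure M] [AddCommGroup M] [LinearOrder M] [IsOrderedAddMonoid M]
    [Module (RatFunc ℚ) M] [LangLt.Structure N] [AddCommGroup N] [LinearOrder N]
    [IsOrderedAddMonoid N] [Module (RatFunc ℚ) N], IsLtSpace M → IsLtSpace N →
    ∀ (x : Fin n → M) (y : Fin n → N), (∀ w ∈ F, SameSign (evalForm x w) (evalForm y w)) →
      (φ.Realize default x ↔ φ.Realize default y)

theorem exists_determinedBy_all {n : ℕ} {φ : LangLt.BoundedFormula Empty (n + 1)}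
    {F : Finset (RatFunc ℚ × (Fin (n + 1) → RatFunc ℚ))} (hF : DeterminedBy φ F) :
    ∃ F', DeterminedBy φ.all F' := by
  classical
  obtain ⟨F', hF'⟩ := exists_finset_elim_field (F.image fun w =>
    (w.2 (Fin.last n), ((w.1, fun i => w.2 i.castSucc) : RatFunc ℚ × (Fin n → RatFunc ℚ))))
  -- A counterexample `z` in `M` is matched by some `z'` in `N`. Exchanging `M` and `N` gives the
  -- other implication.
  have key : ∀ (M N : Type) [LangLt.Structure M] [AddCommGroup M] [LinearOrder M]
      [IsOrderedAddMonoid M] [Module (RatFunc ℚ) M] [LangLt.Structure N] [AddCommGroup N]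
      [LinearOrder N] [IsOrderedAddMonoid N] [Module (RatFunc ℚ) N], IsLtSpace M → IsLtSpace N →
      ∀ (x : Fin n → M) (y : Fin n → N), (∀ w ∈ F', SameSign (evalForm x w) (evalForm y w)) →
        φ.all.Realize default y → φ.all.Realize default x := by
    intro M N _ _ _ _ _ _ _ _ _ _ hM hN x y h hy z
    let _ : Module ℚ M := Module.compHom M (algebraMap ℚ (RatFunc ℚ))
    let _ : Module ℚ N := Module.compHom N (algebraMap ℚ (RatFunc ℚ))
    have : @IsScalarTower ℚ (RatFunc ℚ) M Algebra.toSMul _ _ :=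
      IsScalarTower.of_algebraMap_smul fun _ _ => rfl
    have : @IsScalarTower ℚ (RatFunc ℚ) N Algebra.toSMul _ _ :=
      IsScalarTower.of_algebraMap_smul fun _ _ => rfl
    have : Nontrivial N := ⟨0, _, hN.one_pos.ne⟩
    obtain ⟨z', hz'⟩ := hF' M N hN.dense (evalForm x) (evalForm y) h z
    refine (hF M N hM hN _ _ fun w hw => ?_).2 (hy z')
    rw [evalForm_snoc, evalForm_snoc]
    exact hz' _ (Finset.mem_image_of_mem _ hw)
  exact ⟨F', fun M N _ _ _ _ _ _ _ _ _ _ hM hN x y h =>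
    ⟨key N M hN hM y x fun w hw => (h w hw).symm, key M N hM hN x y h⟩⟩

theorem exists_determinedBy {n : ℕ} (φ : LangLt.BoundedFormula Empty n) :
    ∃ F, DeterminedBy φ F := by
  classical
  induction φ with
  | falsum => exact ⟨∅, fun M N _ _ _ _ _ _ _ _ _ _ hM hN x y h => Iff.rfl⟩
  | equal t u =>
    obtain ⟨w, hw⟩ := exists_evalForm_eq_realize t
    obtain ⟨r, hr⟩ := exists_evalForm_eq_realize u
    refine ⟨{w - r}, fun M N _ _ _ _ _ _ _ _ _ _ hM hN x y h => ?_⟩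
    have := (h _ (Finset.mem_singleton_self _)).eq_zero_iff
    simpa [BoundedFormula.Realize, hw M hM, hw N hN, hr M hM, hr N hN, sub_eq_zero] using this
  | rel R ts =>
    rcases R with R | R
    · obtain ⟨⟩ := R
      obtain ⟨w, hw⟩ := exists_evalForm_eq_realize (ts 0)
      obtain ⟨r, hr⟩ := exists_evalForm_eq_realize (ts 1)
      refine ⟨{w - r}, fun M N _ _ _ _ _ _ _ _ _ _ hM hN x y h => ?_⟩
      have key : ∀ (M : Type) [LangLt.Structure M] [AddCommGroup M] [LinearOrder M]
          [IsOrderedAddMonoid M] [Module (RatFunc ℚ) M] (_ : IsLtSpace M) (x : Fin _ → M),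
          BoundedFormula.Realize (BoundedFormula.rel (Sum.inl OrdGroupRel.lt) ts) default x ↔
            evalForm x (w - r) < 0 := by
        intro M _ _ _ _ _ hM x
        change Structure.RelMap (L := LangLt) ltSym
          (fun i => (ts i).realize (Sum.elim default x)) ↔ _
        rw [map_sub, sub_neg, ← hw M hM default, ← hr M hM default, ← hM.lt_iff]
        have e : (fun i => (ts i).realize (Sum.elim default x)) =
            ![(ts 0).realize (Sum.elim default x), (ts 1).realize (Sum.elim default x)] := by
          ext i
          fin_cases i <;> rfl
        rw [e]
      exact (key M hM x).trans ((h _ (Finset.mem_singleton_self _)).2.trans (key N hN y).symm)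
    · exact R.elim
  | imp _ _ ih₁ ih₂ =>
    obtain ⟨F₁, h₁⟩ := ih₁
    obtain ⟨F₂, h₂⟩ := ih₂
    refine ⟨F₁ ∪ F₂, fun M N _ _ _ _ _ _ _ _ _ _ hM hN x y h => ?_⟩
    rw [BoundedFormula.realize_imp, BoundedFormula.realize_imp,
      h₁ M N hM hN x y fun w hw => h w (Finset.mem_union_left _ hw),
      h₂ M N hM hN x y fun w hw => h w (Finset.mem_union_right _ hw)]
  | all _ ih =>
    obtain ⟨F, hF⟩ := ih
    exact exists_determinedBy_all hF

/-! ### The type of `(λ_p(1))_{p ∈ I}` determines the signs of all `λ_s(1)` -/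

theorem realize_onTerm_add {α M : Type} [LangLt.Structure M] [AddCommGroup M] [LinearOrder M]
    [Module (RatFunc ℚ) M] (hM : IsLtSpace M) (t u : LangL.Term α) (v : α → M) :
    (inclL.onTerm (OrdGroupSyntax.addSym.apply₂ t u)).realize v =
      (inclL.onTerm t).realize v + (inclL.onTerm u).realize v := by
  rw [← hM.add_eq]
  change Structure.funMap (L := LangLt) addSym _ = _
  congr 1
  ext i
  fin_cases i <;> rfl

theorem realize_onTerm_zero {α M : Type} [LangLt.Structure M] [AddCommGroup M] [LinearOrder M]
    [Module (RatFunc ℚ) M] (hM : IsLtSpace M) (v : α → M) :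
    (inclL.onTerm (OrdGroupSyntax.zeroSym.term : LangL.Term α)).realize v = 0 := by
  rw [← hM.zero_eq]
  change Structure.funMap (L := LangLt) zeroSym _ = _
  rw [funMap_eq_coe_constants]

/-- The term `t + ⋯ + t` with `n` summands. -/
def nsmulTerm {α : Type} (t : LangL.Term α) : ℕ → LangL.Term α
  | 0 => OrdGroupSyntax.zeroSym.term
  | n + 1 => OrdGroupSyntax.addSym.apply₂ (nsmulTerm t n) t

theorem realize_onTerm_nsmul {α M : Type} [LangLt.Structure M] [AddCommGroup M] [LinearOrder M]
    [Module (RatFunc ℚ) M] (hM : IsLtSpace M) (t : LangL.Term α) (v : α → M) (n : ℕ) :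
    (inclL.onTerm (nsmulTerm t n)).realize v = n • (inclL.onTerm t).realize v := by
  induction n with
  | zero => rw [zero_smul, nsmulTerm, realize_onTerm_zero hM]
  | succ n ih => rw [nsmulTerm, realize_onTerm_add hM, ih, succ_nsmul]

theorem realize_onFormula_lt {α M : Type} [LangLt.Structure M] [AddCommGroup M] [LinearOrder M]
    [Module (RatFunc ℚ) M] (hM : IsLtSpace M) (t u : LangL.Term α) (v : α → M) :
    (inclL.onFormula (OrdGroupSyntax.ltSym.formula₂ t u)).Realize v ↔
      (inclL.onTerm t).realize v < (inclL.onTerm u).realize v := by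
  let _ : LangL.Structure M := inclL.reduct M
  have : inclL.IsExpansionOn M := LHom.isExpansionOn_reduct inclL M
  rw [LHom.realize_onFormula, Formula.realize_rel₂, LHom.realize_onTerm, LHom.realize_onTerm,
    ← hM.lt_iff]
  rfl

/-- Up to a positive integer factor, `λ_s(1)` is a difference of `L`-terms in the `λ_p(1)` with `p`
in a given set spanning `s`. -/
theorem exists_terms_of_mem_span {I : Set (RatFunc ℚ)} {s : RatFunc ℚ}
    (hs : s ∈ Submodule.span ℚ I) :
    ∃ (d : ℕ) (t u : LangL.Term I), 0 < d ∧ ∀ (M : Type) [LangLt.Structure M] [AddCommGroup M]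
      [LinearOrder M] [Module (RatFunc ℚ) M], IsLtSpace M → ∀ a : M,
        d • s • a = (inclL.onTerm t).realize (fun p : I => p.1 • a) -
          (inclL.onTerm u).realize (fun p : I => p.1 • a) := by
  induction hs using Submodule.span_induction with
  | mem p hp =>
    refine ⟨1, Term.var ⟨p, hp⟩, OrdGroupSyntax.zeroSym.term, one_pos, fun M _ _ _ _ hM a => ?_⟩
    rw [realize_onTerm_zero hM, sub_zero, one_smul]
    rfl
  | zero =>
    refine ⟨1, OrdGroupSyntax.zeroSym.term, OrdGroupSyntax.zeroSym.term, one_pos,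
      fun M _ _ _ _ hM a => ?_⟩
    rw [sub_self, zero_smul, smul_zero]
  | add x y _ _ hx hy =>
    obtain ⟨d, t, u, hd, h⟩ := hx
    obtain ⟨d', t', u', hd', h'⟩ := hy
    refine ⟨d * d', OrdGroupSyntax.addSym.apply₂ (nsmulTerm t d') (nsmulTerm t' d),
      OrdGroupSyntax.addSym.apply₂ (nsmulTerm u d') (nsmulTerm u' d), Nat.mul_pos hd hd',
      fun M _ _ _ _ hM a => ?_⟩
    simp only [realize_onTerm_add hM, realize_onTerm_nsmul hM]
    rw [add_sub_add_comm, ← nsmul_sub, ← nsmul_sub, ← h M hM, ← h' M hM, add_smul, nsmul_add,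
      mul_nsmul, mul_nsmul']
  | smul q x _ hx =>
    obtain ⟨d, t, u, hd, h⟩ := hx
    have key : ∀ (M : Type) [AddCommGroup M] [Module (RatFunc ℚ) M] (a : M),
        (q.den * d) • (algebraMap ℚ (RatFunc ℚ) q * x) • a = q.num • (d • x • a) := by
      intro M _ _ a
      have e : ((q.den * d : ℕ) : RatFunc ℚ) * (algebraMap ℚ (RatFunc ℚ) q * x) =
          (q.num : RatFunc ℚ) * d * x := by
        rw [Nat.cast_mul]
        have : (q.den : RatFunc ℚ) * algebraMap ℚ (RatFunc ℚ) q = (q.num : RatFunc ℚ) := by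
          rw [← map_natCast (algebraMap ℚ (RatFunc ℚ)), ← map_mul, Rat.den_mul_eq_num,
            map_intCast]
        rw [← this]
        ring
      rw [← Nat.cast_smul_eq_nsmul (RatFunc ℚ), ← Int.cast_smul_eq_zsmul (RatFunc ℚ),
        ← Nat.cast_smul_eq_nsmul (RatFunc ℚ) d, smul_smul, smul_smul, smul_smul, e]
    -- The language has no subtraction, so a negative numerator exchanges the two terms.
    rcases Int.eq_nat_or_neg q.num with ⟨n, hn | hn⟩
    · refine ⟨q.den * d, nsmulTerm t n, nsmulTerm u n, Nat.mul_pos q.den_pos hd,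
        fun M _ _ _ _ hM a => ?_⟩
      rw [Algebra.smul_def, key, h M hM, realize_onTerm_nsmul hM, realize_onTerm_nsmul hM, hn, natCast_zsmul,
        nsmul_sub]
    · refine ⟨q.den * d, nsmulTerm u n, nsmulTerm t n, Nat.mul_pos q.den_pos hd,
        fun M _ _ _ _ hM a => ?_⟩
      rw [Algebra.smul_def, key, h M hM, realize_onTerm_nsmul hM, realize_onTerm_nsmul hM, hn, neg_smul,
        natCast_zsmul, nsmul_sub, neg_sub]

namespace RtData

variable (D : RtData)

theorem realize_typeFormula {M : Type} [LangLt.Structure M] (φ : LangL.Formula D.I) :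
    Sentence.Realize M ((inclL.onFormula φ).subst fun p : D.I => lamT p.1 oneT) ↔
      (inclL.onFormula φ).Realize fun p : D.I =>
        Structure.funMap (lamSym p.1) ![((oneSym : LangLt.Constants) : M)] := by
  rw [Sentence.Realize, Formula.Realize, BoundedFormula.realize_subst]
  simp only [lamT, oneT, Term.realize_functions_apply₁, Term.realize_constants]
  rfl

theorem mem_typeOne (φ : LangL.Formula D.I) :
    Formula.equivSentence φ ∈ D.typeOne ↔ φ.Realize fun p : D.I => D.lam p 1 :=
  have : ℝ ⊨ theoryT := inferInstanceAs (ℝ ⊨ LangL.completeTheory ℝ)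
  Theory.CompleteType.formula_mem_typeOf

/-- A complete type contains each formula or its negation, so the forward transfer applied to
`φ.not` gives the converse. -/
theorem realize_typeFormula_iff {M : Type} [LangLt.Structure M] (hM : M ⊨ D.typeAxioms)
    (φ : LangL.Formula D.I) :
    (inclL.onFormula φ).Realize (fun p : D.I =>
        Structure.funMap (lamSym p.1) ![((oneSym : LangLt.Constants) : M)]) ↔
      φ.Realize fun p : D.I => D.lam p 1 := by
  have key : ∀ φ : LangL.Formula D.I, (φ.Realize fun p : D.I => D.lam p 1) →
      (inclL.onFormula φ).Realize (fun p : D.I =>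
        Structure.funMap (lamSym p.1) ![((oneSym : LangLt.Constants) : M)]) := fun φ hφ =>
    (D.realize_typeFormula φ).1 (hM.realize_of_mem _ ⟨φ, (D.mem_typeOne φ).2 hφ, rfl⟩)
  refine ⟨fun h => ?_, key φ⟩
  by_contra hn
  exact key φ.not hn h

/-- The formula depends on `s` alone and is evaluated in `ℝ`, so the sign of $\lambda_s(1)$ is the
same in all models. -/
theorem exists_formula_pos (s : RatFunc ℚ) : ∃ φ : LangL.Formula D.I, ∀ (M : Type)
    [LangLt.Structure M] [AddCommGroup M] [LinearOrder M] [IsOrderedAddMonoid M]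
    [Module (RatFunc ℚ) M], IsLtSpace M → M ⊨ D.typeAxioms →
      (0 < s • (oneSym : M) ↔ φ.Realize fun p : D.I => D.lam p 1) := by
  obtain ⟨d, t, u, hd, h⟩ := exists_terms_of_mem_span (I := D.I) (s := s)
    (by rw [D.I_span]; trivial)
  refine ⟨OrdGroupSyntax.ltSym.formula₂ u t, fun M _ _ _ _ _ hM hA => ?_⟩
  rw [← D.realize_typeFormula_iff hA, realize_onFormula_lt hM, ← nsmul_pos_iff hd.ne', h M hM,
    sub_pos]
  simp only [hM.lam_eq]

/-- A sentence has no free variables, so its forms are the `w.1 • 1`; positivity for `w.1` and for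
`-w.1` gives both halves of the sign. -/
theorem realize_sentence_of_models {M N : Type} [LangLt.Structure M] [LangLt.Structure N]
    (hM : M ⊨ theoryTt ∪ D.typeAxioms) (hN : N ⊨ theoryTt ∪ D.typeAxioms)
    {φ : LangLt.Sentence} (h : M ⊨ φ) : N ⊨ φ := by
  rw [Theory.model_union_iff] at hM hN
  obtain ⟨_, _, _, _, hM'⟩ := IsLtSpace.exists_of_model M hM.1
  obtain ⟨_, _, _, _, hN'⟩ := IsLtSpace.exists_of_model N hN.1
  obtain ⟨F, hF⟩ := exists_determinedBy φ
  have hpos : ∀ s : RatFunc ℚ, 0 < s • (oneSym : M) ↔ 0 < s • (oneSym : N) := by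
    intro s
    obtain ⟨ψ, hψ⟩ := D.exists_formula_pos s
    rw [hψ M hM' hM.2, hψ N hN' hN.2]
  refine (hF M N hM' hN' default default fun w _ => ?_).1 h
  simp only [evalForm_apply, Finset.univ_eq_empty, Finset.sum_empty, add_zero]
  refine ⟨hpos w.1, ?_⟩
  have := hpos (-w.1)
  rwa [neg_smul, neg_smul, neg_pos, neg_pos] at this

/-! ### `R_t` is a model of the axioms -/

/-- Each $\lambda_q$ is coordinatewise multiplication by $q$ transported along `sumEquiv`; the
vector space axioms follow. -/
theorem lam_eq (q : RatFunc ℚ) (a : ℝ) : D.lam q a = D.sumEquiv (q • D.sumEquiv.symm a) := by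
  change _ = Finsupp.lsum ℚ D.fLin _
  rw [Finsupp.lsum_apply, Finsupp.sum_smul_index' (fun i => map_zero _)]
  rfl

theorem lam_fLin (q r : RatFunc ℚ) (γ : ℕ → Bool) : D.lam q (D.fLin γ r) = D.fLin γ (q * r) := by
  have h : ∀ r, D.sumEquiv (Finsupp.single γ r) = D.fLin γ r := fun r =>
    Finsupp.lsum_single ℚ D.fLin γ r
  rw [lam_eq, ← h, LinearEquiv.symm_apply_apply, Finsupp.smul_single, h, smul_eq_mul]

theorem fLin_apply (γ : ℕ → Bool) (r : RatFunc ℚ) (S : Finset D.I)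
    (hS : (D.basisI.repr r).support ⊆ S) :
    D.fLin γ r = ∑ p ∈ S, D.basisI.repr r p • (D.f γ p : ℝ) := by
  rw [fLin, Module.Basis.constr_apply, Finsupp.sum_of_support_subset _ hS]
  simp

theorem exists_linearMap_apply_eq {m : ℕ} {q : Fin m → RatFunc ℚ} (hq : LinearIndependent ℚ q)
    (w : Fin m → ℚ) : ∃ g : RatFunc ℚ →ₗ[ℚ] ℚ, ∀ i, g (q i) = w i := by
  obtain ⟨g, hg⟩ := LinearMap.exists_extend ((Module.Basis.span hq).constr ℚ w)
  refine ⟨g, fun i => ?_⟩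
  have := LinearMap.congr_fun hg (Module.Basis.span hq i)
  rw [Module.Basis.constr_basis] at this
  rw [← this, LinearMap.comp_apply, Submodule.subtype_apply, Module.Basis.span_apply]

/-- The witness is $x=f_\gamma(1)$, for which $\lambda_{q_i}(x)=f_\gamma(q_i)$ is a fixed finite
$\mathbb{Q}$-combination of values $\tilde f_\gamma(p)$. A functional $g$ with $g(q_i)\in(a_i,b_i)$
shows that the values $g(p)$ would do; by continuity nearby ones do too, and some $\tilde f_\gamma$
attains such values. -/
theorem exists_lam_mem_Ioo {m : ℕ} (q : Fin m → RatFunc ℚ) (hq : LinearIndependent ℚ q)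
    (a b : Fin m → ℝ) (hab : ∀ i, a i < b i) :
    ∃ x : ℝ, ∀ i, a i < D.lam (q i) x ∧ D.lam (q i) x < b i := by
  classical
  choose w hw using fun i => exists_rat_btwn (hab i)
  obtain ⟨g, hg⟩ := exists_linearMap_apply_eq hq w
  let S : Finset D.I := Finset.univ.biUnion fun i => (D.basisI.repr (q i)).support
  have hS : ∀ i, (D.basisI.repr (q i)).support ⊆ S := fun i =>
    Finset.subset_biUnion_of_mem (fun i => (D.basisI.repr (q i)).support) (Finset.mem_univ i)
  have hopen : IsOpen {y : D.I → ℝ | ∀ i, a i < ∑ p ∈ S, D.basisI.repr (q i) p • y p ∧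
      ∑ p ∈ S, D.basisI.repr (q i) p • y p < b i} := by
    simp only [Set.ofPred_forall]
    refine isOpen_iInter_of_finite fun i => ?_
    have hc : Continuous fun y : D.I → ℝ => ∑ p ∈ S, D.basisI.repr (q i) p • y p := by
      fun_prop
    exact (isOpen_lt continuous_const hc).inter (isOpen_lt hc continuous_const)
  have hmem : (fun p : D.I => (g p.1 : ℝ)) ∈ {y : D.I → ℝ | ∀ i,
      a i < ∑ p ∈ S, D.basisI.repr (q i) p • y p ∧
      ∑ p ∈ S, D.basisI.repr (q i) p • y p < b i} := by
    intro i
    have : ∑ p ∈ S, D.basisI.repr (q i) p • (g p.1 : ℝ) = w i := by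
      rw [← hg i]
      conv_rhs => rw [← D.basisI.linearCombination_repr (q i), Finsupp.linearCombination_apply,
        Finsupp.sum_of_support_subset _ (hS i) _ (by simp), map_sum, Rat.cast_sum]
      refine Finset.sum_congr rfl fun p _ => ?_
      rw [LinearMap.map_smul, smul_eq_mul, Rat.cast_mul, Rat.smul_def, basisI, Module.Basis.mk_apply]
    rw [this]
    exact hw i
  -- A basic open set of the product constrains only the finitely many coordinates in `T`, as
  -- `f_dense` needs.
  obtain ⟨T, U, hU, hTU⟩ := isOpen_pi_iff.1 hopen _ hmem
  have hJ : ∀ p : T, ∃ l u : ℝ, l < u ∧ Set.Ioo l u ⊆ U p := by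
    intro p
    obtain ⟨l, u, hlu, h⟩ := mem_nhds_iff_exists_Ioo_subset.1
      ((hU p p.2).1.mem_nhds (hU p p.2).2)
    exact ⟨l, u, hlu.1.trans hlu.2, h⟩
  choose l u hlu hsub using hJ
  obtain ⟨γ, hγ⟩ := D.f_dense T.card (fun j => (T.equivFin.symm j : D.I))
    (fun j => l (T.equivFin.symm j)) (fun j => u (T.equivFin.symm j))
    (Subtype.val_injective.comp T.equivFin.symm.injective) fun j => hlu _
  refine ⟨D.fLin γ 1, fun i => ?_⟩
  rw [lam_fLin, mul_one, D.fLin_apply γ (q i) S (hS i)]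
  refine hTU (a := fun p => (D.f γ p : ℝ)) (fun p hp => hsub ⟨p, hp⟩ ?_) i
  simpa using hγ (T.equivFin ⟨p, hp⟩)

theorem model_theoryTt_union_typeAxioms :
    letI := D.structureRt
    ℝ ⊨ theoryTt ∪ D.typeAxioms := by
  let _ := D.lamStructure
  have hlam : ∀ (q : RatFunc ℚ) (x : ℝ),
      Structure.funMap (L := LangLt) (lamSym q) ![x] = D.lam q x := fun _ _ => rfl
  have hadd : ∀ x y : ℝ, Structure.funMap (L := LangLt) addSym ![x, y] = x + y := fun _ _ => rfl
  have hzero : ((zeroSym : LangLt.Constants) : ℝ) = 0 := rfl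
  have hone : ((oneSym : LangLt.Constants) : ℝ) = 1 := rfl
  rw [theoryTt, Theory.model_union_iff, Theory.model_union_iff, Theory.model_union_iff]
  refine ⟨⟨⟨?_, ?_⟩, ?_⟩, ?_⟩
  · rw [LHom.onTheory_model]
    exact inferInstanceAs (ℝ ⊨ LangL.completeTheory ℝ)
  · rw [realize_vectorSpaceAxioms]
    simp only [hlam, hadd, hzero, lam_eq, map_add, smul_add, add_smul, mul_smul, one_smul,
      LinearEquiv.symm_apply_apply, LinearEquiv.apply_symm_apply, implies_true, add_zero, and_true,
      true_and]
    exact ⟨add_assoc, add_comm, fun x => ⟨-x, add_neg_cancel x⟩⟩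
  · rw [Theory.model_iff]
    rintro _ ⟨m, q, hq, rfl⟩
    exact (realize_densitySentence ℝ q).2 fun a b hab => D.exists_lam_mem_Ioo q hq a b hab
  · rw [Theory.model_iff]
    rintro _ ⟨φ, hφ, rfl⟩
    rw [realize_typeFormula, LHom.realize_onFormula]
    simp only [hlam, hone]
    exact (D.mem_typeOne φ).1 hφ

end RtData

end

theorem mainTheorem10 (D : RtData) :
    {φ : LangLt.Sentence | (theoryTt ∪ D.typeAxioms) ⊨ᵇ φ} = D.theoryRt := by
  let _ := D.structureRt
  have hR := D.model_theoryTt_union_typeAxioms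
  ext φ
  constructor
  · intro h
    exact mem_completeTheory.2 (Theory.ModelsBoundedFormula.realize_sentence h ℝ)
  · intro h
    refine Theory.models_sentence_iff.2 fun M => ?_
    exact D.realize_sentence_of_models hR M.is_model (mem_completeTheory.1 h)
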